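/- Let $r\ge 3$ be an integer. Let $M$ be the $2r\times 2r$ block diagonal matrix over $\mathbb F_2$ with diagonal blocks $\begin{bmatrix}0&-1\\1&0\end{bmatrix}$. The hyperbolic quadric graph $O^+(2r,2)$ has as vertices the vectors $x=(x_1,\dots,x_{2r})^t\in\mathbb F_2^{2r}$ with $x_1x_2+x_3x_4+\dots+x_{2r-1}x_{2r}=1$, and two vertices $x,y$ are adjacent ($x\sim y$) if and only if $x^tMy=1$. For a graph $G$ and a set $X$ of vertices, put $N(X)=\{y\notin X : y\sim x \text{ for some } x\in X\}$, and let $\kappa_2(G)$ be the minimum size of a set of vertices of $G$ whose removal leaves a disconnected graph all of whose components have at least two vertices. The graph $O^+(2r,2)$ is connected and strongly regular with parameters $$(v,k,\lambda,\mu)=(2^{2r-1}-2^{r-1},\ 2^{2r-2}-2^{r-1},\ 2^{2r-3}-2^{r-2},\ 2^{2r-3}-2^{r-1}),$$ and $$\kappa_2(O^+(2r,2))=2k-\lambda-3=3(2^{2r-3}-2^{r-2})-3.$$ Moreover, the sets of vertices of size $\kappa_2(O^+(2r,2))$ whose removal leaves a disconnected graph with all components having at least two vertices are exactly the neighbourhoods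 $N(\{x,y,x+y\})$ of hyperbolic lines $\{x,y,x+y\}$, where $x,y$ are adjacent vertices (in which case $x+y$ is also a vertex). -/

import Mathlib

open scoped Matrix

/-- The neighbourhood `N(X)` of a set of vertices: the vertices outside `X` that are adjacent to
some vertex of `X`. -/
def nbhd {V : Type*} (G : SimpleGraph V) (X : Set V) : Set V :=
  {y | y ∉ X ∧ ∃ x ∈ X, G.Adj x y}

/-- Removing `S` leaves a disconnected graph, all of whose components have at least two
vertices. (`Preconnected` is used so that removing every vertex does not count as
disconnecting.) -/
structure IsNonsingletonDisconnecting {V : Type*} (G : SimpleGraph V) (S : Set V) : Prop where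
  disconnected : ¬ (G.induce Sᶜ).Preconnected
  nonsingleton : ∀ c : (G.induce Sᶜ).ConnectedComponent, c.supp.Nontrivial

/-- `κ₂(G)`: the minimum size of a set whose removal disconnects `G` into non-singleton
components (and `⊤` if there is no such set). -/
noncomputable def kappaTwo {V : Type*} (G : SimpleGraph V) : ℕ∞ :=
  ⨅ (S : Set V) (_ : IsNonsingletonDisconnecting G S), S.encard

/-- The space `𝔽₂²ʳ`. The `i`-th pair of coordinates `(x_{2i-1}, x_{2i})` of a vector `x` is
`(x (0, i), x (1, i))`. -/
abbrev BinVec (r : ℕ) : Type := Fin 2 × Fin r → ZMod 2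

/-- The block diagonal `2r × 2r` matrix with diagonal blocks `[0, -1; 1, 0]`. -/
def sympMatrix (r : ℕ) : Matrix (Fin 2 × Fin r) (Fin 2 × Fin r) (ZMod 2) :=
  Matrix.blockDiagonal (fun _ : Fin r => !![0, -1; 1, 0])

/-- The hyperbolic quadratic form `x₁x₂ + x₃x₄ + ⋯ + x_{2r-1}x_{2r}`. -/
def hypForm {r : ℕ} (x : BinVec r) : ZMod 2 := ∑ i : Fin r, x (0, i) * x (1, i)

/-- The vertices of `O⁺(2r,2)`: the complement of the hyperbolic quadric in `𝔽₂²ʳ`. -/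
abbrev OPlusVertex (r : ℕ) : Type := {x : BinVec r // hypForm x = 1}

theorem sympMatrix_form {r : ℕ} (x y : BinVec r) :
    x ⬝ᵥ (sympMatrix r *ᵥ y) = ∑ i : Fin r, (x (0, i) * y (1, i) + x (1, i) * y (0, i)) := by
  simp only [dotProduct, Matrix.mulVec, sympMatrix, Matrix.blockDiagonal_apply,
    Fintype.sum_prod_type, Fin.sum_univ_two, ite_mul, zero_mul, Finset.sum_ite_eq,
    Finset.mem_univ, if_true, Matrix.of_apply, Matrix.cons_val_zero, Matrix.cons_val_one,
    Finset.sum_add_distrib]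
  simp [ZMod.neg_eq_self_mod_two]

/-- The hyperbolic quadric graph `O⁺(2r,2)`: `x` and `y` are adjacent when `xᵗ M y = 1`. -/
def OPlus (r : ℕ) : SimpleGraph (OPlusVertex r) where
  Adj x y := x.1 ⬝ᵥ (sympMatrix r *ᵥ y.1) = 1
  symm := ⟨by
    intro x y h
    rw [sympMatrix_form] at h ⊢
    exact (Finset.sum_congr rfl fun i _ => by ring).trans h⟩
  loopless := ⟨by
    intro x h
    rw [sympMatrix_form] at h
    have h0 : ∀ a b : ZMod 2, a * b + b * a = 0 := by decide
    simp [h0] at h⟩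

instance (r : ℕ) : DecidableRel (OPlus r).Adj := fun x y =>
  inferInstanceAs (Decidable (x.1 ⬝ᵥ (sympMatrix r *ᵥ y.1) = 1))

theorem hypForm_add {r : ℕ} (x y : BinVec r) :
    hypForm (x + y) = hypForm x + hypForm y + x ⬝ᵥ (sympMatrix r *ᵥ y) := by
  rw [sympMatrix_form]
  simp only [hypForm, ← Finset.sum_add_distrib, Pi.add_apply]
  exact Finset.sum_congr rfl fun i _ => by ring

/-- The vertex `x + y` of `O⁺(2r,2)`, for adjacent vertices `x` and `y`. -/
def OPlus.sum {r : ℕ} {x y : OPlusVertex r} (h : (OPlus r).Adj x y) : OPlusVertex r :=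
  ⟨x.1 + y.1, by
    have h1 : x.1 ⬝ᵥ (sympMatrix r *ᵥ y.1) = 1 := h
    rw [hypForm_add, x.2, y.2, h1]
    decide⟩

/-- The hyperbolic line `{x, y, x + y}` spanned by adjacent vertices `x` and `y`. -/
def OPlus.hyperbolicLine {r : ℕ} {x y : OPlusVertex r} (h : (OPlus r).Adj x y) :
    Set (OPlusVertex r) :=
  {x, y, OPlus.sum h}

/-! Write N = 2^r, Q for `hypForm`, and E(U) for the sum of (-1)^Q over a subgroup U. A subgroup U
contains (|U| - E(U))/2 vertices, and Poisson summation gives |U| |U^⊥| = N^2 and |U| E(U^⊥) = N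
E(U). All counts below reduce to such sums.

If removing S leaves nontrivial components, split the remaining vertices into sets A and B with no
edges between them, each containing an edge. With U the span of A, B lies in U^⊥. Since |U| |U^⊥| =
N^2, one may assume |U| ≤ N, exchanging A and B if necessary. As U contains a hyperbolic line, E(U)
≥ -|U|/2, hence E(U^⊥) ≥ -N/2, and so 8(|A| + |B|) ≤ 6|U| + 4|U^⊥| + 2N. The order |U| is a power of
two, at least 4. The right side is strictly largest at |U| = 4, where U is {0, x, y, x + y};
equality then forces A and B to be all the vertices of U and U^⊥, so S is the neighbourhood of the
line. Conversely these neighbourhoods disconnect as required and attain the bound. -/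

/-! ### Character sums over subgroups and counts of vertices. -/

section CharacterSums

variable {r : ℕ}

/-- The symplectic form `xᵗ M y`. -/
def sympForm (x y : BinVec r) : ZMod 2 := x ⬝ᵥ (sympMatrix r *ᵥ y)

theorem OPlus_adj_iff {x y : OPlusVertex r} : (OPlus r).Adj x y ↔ sympForm x.1 y.1 = 1 := Iff.rfl

theorem hypForm_add' (x y : BinVec r) :
    hypForm (x + y) = hypForm x + hypForm y + sympForm x y := hypForm_add x y

theorem sympForm_add_left (x y z : BinVec r) :
    sympForm (x + y) z = sympForm x z + sympForm y z := add_dotProduct _ _ _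

theorem sympForm_add_right (x y z : BinVec r) :
    sympForm x (y + z) = sympForm x y + sympForm x z := by
  simp [sympForm, Matrix.mulVec_add, dotProduct_add]

theorem sympForm_comm (x y : BinVec r) : sympForm x y = sympForm y x := by
  simp only [sympForm, sympMatrix_form]
  exact Finset.sum_congr rfl fun i _ => by ring

theorem sympForm_self (x : BinVec r) : sympForm x x = 0 := by
  simp only [sympForm, sympMatrix_form]
  exact Finset.sum_eq_zero fun i _ => by rw [mul_comm, CharTwo.add_self_eq_zero]

@[simp] theorem sympForm_zero_left (x : BinVec r) : sympForm 0 x = 0 := by simp [sympForm]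

@[simp] theorem sympForm_zero_right (x : BinVec r) : sympForm x 0 = 0 := by simp [sympForm]

@[simp] theorem hypForm_zero : hypForm (0 : BinVec r) = 0 := by simp [hypForm]

theorem BinVec.add_self (x : BinVec r) : x + x = 0 := by
  funext i; exact CharTwo.add_self_eq_zero _

theorem zmod_two_ne_one {a : ZMod 2} : a ≠ 1 ↔ a = 0 := by
  revert a; decide

theorem exists_sympForm_eq_one {x : BinVec r} (hx : x ≠ 0) : ∃ y, sympForm x y = 1 := by
  by_contra! h
  apply hx
  funext ⟨a, i⟩
  -- The basis vector at the partner coordinate in the same hyperbolic pair reads off the coordinate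
  -- `(a, i)` of `x`.
  have h1 := h (Pi.single (1 - a, i) 1)
  rw [zmod_two_ne_one, sympForm, sympMatrix_form, Finset.sum_eq_single i] at h1
  · fin_cases a <;> simpa [Pi.single_apply] using h1
  · intro j _ hj
    simp [hj]
  · simp

/-- The nontrivial additive character of `𝔽₂`, with values in `ℤ`. -/
def binSign (a : ZMod 2) : ℤ := if a = 0 then 1 else -1

@[simp] theorem binSign_zero : binSign 0 = 1 := rfl

@[simp] theorem binSign_one : binSign 1 = -1 := rfl

theorem binSign_add (a b : ZMod 2) : binSign (a + b) = binSign a * binSign b := by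
  revert a b; decide

theorem one_sub_binSign (a : ZMod 2) : 1 - binSign a = 2 * if a = 1 then 1 else 0 := by
  revert a; decide

theorem binSign_sum {ι : Type*} (s : Finset ι) (f : ι → ZMod 2) :
    binSign (∑ i ∈ s, f i) = ∏ i ∈ s, binSign (f i) := by
  classical
  induction s using Finset.induction_on with
  | empty => simp
  | insert a s ha ih => rw [Finset.sum_insert ha, Finset.prod_insert ha, binSign_add, ih]

/-- The sum factors over the r hyperbolic pairs; each contributes 3 - 1 = 2. -/
theorem sum_binSign_hypForm : ∑ w : BinVec r, binSign (hypForm w) = 2 ^ r := by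
  let e : BinVec r ≃ (Fin r → Fin 2 → ZMod 2) :=
    ((Equiv.prodComm (Fin 2) (Fin r)).arrowCongr (Equiv.refl _)).trans
      (Equiv.curry (Fin r) (Fin 2) (ZMod 2))
  have h : ∀ w : BinVec r, binSign (hypForm w) = ∏ i, binSign (e w i 0 * e w i 1) :=
    fun w => binSign_sum _ _
  rw [Finset.sum_congr rfl fun w _ => h w,
    Equiv.sum_comp e fun g : Fin r → Fin 2 → ZMod 2 => ∏ i, binSign (g i 0 * g i 1),
    ← Fintype.prod_sum fun (_ : Fin r) (a : Fin 2 → ZMod 2) => binSign (a 0 * a 1)]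
  have h2 : ∑ a : Fin 2 → ZMod 2, binSign (a 0 * a 1) = 2 := by decide
  simp [h2]

/-- Completing the square: translation by `y` absorbs the linear term, because Q(w + y) = Q(w) +
Q(y) + ⟨w, y⟩. Thus (-1)^Q is its own Fourier transform up to the factor 2^r. -/
theorem sum_binSign_hypForm_add_sympForm (y : BinVec r) :
    ∑ w : BinVec r, binSign (hypForm w) * binSign (sympForm y w) =
      2 ^ r * binSign (hypForm y) := by
  rw [← sum_binSign_hypForm, Finset.sum_mul, ← Equiv.sum_comp (Equiv.addRight y)]
  refine Finset.sum_congr rfl fun w _ => ?_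
  rw [← binSign_add, ← binSign_add, Equiv.coe_addRight, hypForm_add', sympForm_add_right,
    sympForm_self, sympForm_comm y w, add_zero, add_assoc, CharTwo.add_self_eq_zero, add_zero]

/-- The orthogonal complement of a subgroup. -/
def orthGroup (U : AddSubgroup (BinVec r)) : AddSubgroup (BinVec r) where
  carrier := {w | ∀ u ∈ U, sympForm u w = 0}
  zero_mem' := by simp
  add_mem' := by
    intro a b ha hb u hu
    rw [sympForm_add_right, ha u hu, hb u hu, add_zero]
  neg_mem' := by
    intro a ha u hu
    rw [neg_eq_of_add_eq_zero_left (BinVec.add_self a)]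
    exact ha u hu

theorem mem_orthGroup {U : AddSubgroup (BinVec r)} {w : BinVec r} :
    w ∈ orthGroup U ↔ ∀ u ∈ U, sympForm u w = 0 := Iff.rfl

open scoped Classical in
/-- The sum of `(-1)^{Q(w)}` over a subgroup. -/
noncomputable def quadSum (U : AddSubgroup (BinVec r)) : ℤ := ∑ w : U, binSign (hypForm w.1)

open scoped Classical in
theorem sum_binSign_sympForm_subgroup (U : AddSubgroup (BinVec r)) (w : BinVec r) :
    ∑ u : U, binSign (sympForm u.1 w) = if w ∈ orthGroup U then (Nat.card U : ℤ) else 0 := by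
  split_ifs with h
  · rw [Finset.sum_congr rfl fun u _ => by rw [h u.1 u.2]]
    simp
  · simp only [mem_orthGroup, not_forall] at h
    obtain ⟨u, hu, h1⟩ := h
    have h2 : sympForm u w = 1 := by
      by_contra h3; exact h1 (zmod_two_ne_one.1 h3)
    have h3 : ∑ v : U, binSign (sympForm v.1 w) = ∑ v : U, -binSign (sympForm v.1 w) := by
      rw [← Equiv.sum_comp (Equiv.addRight (⟨u, hu⟩ : U))]
      refine Finset.sum_congr rfl fun v _ => ?_
      simp [sympForm_add_left, binSign_add, h2]
    rw [Finset.sum_neg_distrib] at h3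
    linarith

theorem sum_binSign_sympForm {y : BinVec r} (hy : y ≠ 0) :
    ∑ w : BinVec r, binSign (sympForm y w) = 0 := by
  obtain ⟨z, hz⟩ := exists_sympForm_eq_one hy
  have h3 : ∑ v, binSign (sympForm y v) = ∑ v, -binSign (sympForm y v) := by
    rw [← Equiv.sum_comp (Equiv.addRight z)]
    refine Finset.sum_congr rfl fun v _ => ?_
    simp [sympForm_add_right, binSign_add, hz]
  rw [Finset.sum_neg_distrib] at h3
  linarith

theorem card_binVec : (Fintype.card (BinVec r) : ℤ) = (2 ^ r) ^ 2 := by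
  simp [← pow_mul, mul_comm]

open scoped Classical in
theorem sum_subgroup_eq (U : AddSubgroup (BinVec r)) (f : BinVec r → ℤ) :
    ∑ u : U, f u.1 = ∑ w, if w ∈ U then f w else 0 := by
  rw [← Finset.sum_filter]
  exact (Finset.sum_subtype _ (by simp) f).symm

open scoped Classical in
/-- Poisson summation. -/
theorem poisson_orthGroup (U : AddSubgroup (BinVec r)) (f : BinVec r → ℤ) :
    (Nat.card U : ℤ) * ∑ w : orthGroup U, f w.1 =
      ∑ u : U, ∑ w, f w * binSign (sympForm u.1 w) := by
  rw [Finset.sum_comm, sum_subgroup_eq, Finset.mul_sum]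
  refine Finset.sum_congr rfl fun w _ => ?_
  rw [← Finset.mul_sum, sum_binSign_sympForm_subgroup]
  split_ifs <;> ring

theorem card_mul_card_orthGroup (U : AddSubgroup (BinVec r)) :
    (Nat.card U : ℤ) * Nat.card (orthGroup U) = (2 ^ r) ^ 2 := by
  classical
  have h := poisson_orthGroup U fun _ => 1
  simp only [one_mul] at h
  rw [Finset.sum_eq_single (0 : U)] at h
  · simp only [ZeroMemClass.coe_zero, sympForm_zero_left, binSign_zero, Finset.sum_const,
      Finset.card_univ, nsmul_eq_mul, mul_one] at h
    rw [card_binVec, ← Nat.card_eq_fintype_card] at h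
    exact h
  · exact fun u _ hu => sum_binSign_sympForm fun h => hu (Subtype.ext h)
  · simp

/-- Poisson summation applied to (-1)^Q, which is self-dual up to 2^r. It carries bounds on the sum
over U to bounds over U^⊥. -/
theorem card_mul_quadSum_orthGroup (U : AddSubgroup (BinVec r)) :
    (Nat.card U : ℤ) * quadSum (orthGroup U) = 2 ^ r * quadSum U := by
  classical
  have h := poisson_orthGroup U fun w => binSign (hypForm w)
  simp only [sum_binSign_hypForm_add_sympForm, ← Finset.mul_sum] at h
  unfold quadSum
  convert h

-- This plays the role of U^⊥⊥ = U: a vector outside U gives a nontrivial character on U^⊥. After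
-- Poisson summation the inner sums vanish because `u + z` is never zero.
open scoped Classical in
theorem sum_binSign_sympForm_orthGroup {U : AddSubgroup (BinVec r)} {z : BinVec r} (hz : z ∉ U) :
    ∑ w : orthGroup U, binSign (sympForm z w.1) = 0 := by
  have h := poisson_orthGroup U fun w => binSign (sympForm z w)
  rw [Finset.sum_eq_zero (s := Finset.univ (α := U))] at h
  · exact (mul_eq_zero.1 h).resolve_left (by exact_mod_cast Nat.card_pos.ne')
  · intro u _
    simp only [← binSign_add, ← sympForm_add_left]
    refine sum_binSign_sympForm fun h0 => hz ?_
    have h1 : z = -u.1 := eq_neg_of_add_eq_zero_left h0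
    rw [h1]
    exact U.neg_mem u.2

open scoped Classical in
theorem sum_binSign_hypForm_sympForm_subgroup {U : AddSubgroup (BinVec r)} {z : BinVec r}
    (hz : z ∈ U) :
    ∑ w : U, binSign (hypForm w.1) * binSign (sympForm z w.1) =
      binSign (hypForm z) * quadSum U := by
  rw [quadSum, Finset.mul_sum, ← Equiv.sum_comp (Equiv.addRight (⟨z, hz⟩ : U))]
  refine Finset.sum_congr rfl fun w _ => ?_
  simp only [Equiv.coe_addRight, AddSubgroup.coe_add]
  rw [← binSign_add, ← binSign_add, hypForm_add', sympForm_add_right,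
    sympForm_self, sympForm_comm z w, add_zero, add_assoc, CharTwo.add_self_eq_zero, add_zero,
    add_comm]

/-- Average over the cosets of {0, x, y, x + y}: Q cannot equal 1 at all four points of such a
coset, so the four signs sum to at least -2. -/
theorem neg_card_le_two_mul_quadSum {U : AddSubgroup (BinVec r)} {x y : BinVec r}
    (hx : x ∈ U) (hy : y ∈ U) (hQx : hypForm x = 1) (hQy : hypForm y = 1)
    (hxy : sympForm x y = 1) : -(Nat.card U : ℤ) ≤ 2 * quadSum U := by
  classical
  have shift : ∀ z ∈ U, quadSum U = ∑ w : U, binSign (hypForm (w.1 + z)) := fun z hz => by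
    rw [quadSum, ← Equiv.sum_comp (Equiv.addRight (⟨z, hz⟩ : U))]
    rfl
  have h4 : 4 * quadSum U = ∑ w : U, (binSign (hypForm w.1) + binSign (hypForm (w.1 + x)) +
      binSign (hypForm (w.1 + y)) + binSign (hypForm (w.1 + (x + y)))) := by
    simp only [Finset.sum_add_distrib]
    rw [← shift x hx, ← shift y hy, ← shift _ (U.add_mem hx hy)]
    rw [quadSum]
    ring
  have key : ∀ q a b : ZMod 2, (-2 : ℤ) ≤ binSign q + binSign (q + 1 + a) +
      binSign (q + 1 + b) + binSign (q + (1 + 1 + 1) + (a + b)) := by decide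
  have h5 : ∑ _w : U, (-2 : ℤ) ≤ 4 * quadSum U := by
    rw [h4]
    refine Finset.sum_le_sum fun w _ => ?_
    simp only [hypForm_add', sympForm_add_right, hQx, hQy, hxy]
    exact key _ _ _
  simp only [Finset.sum_const, Finset.card_univ, nsmul_eq_mul,
    ← Nat.card_eq_fintype_card] at h5
  linarith

theorem ncard_oplusVertex (p : BinVec r → Prop) [DecidablePred p] :
    ({v : OPlusVertex r | p v.1}.ncard : ℤ) =
      ∑ w : BinVec r, (if hypForm w = 1 then 1 else 0) * (if p w then 1 else 0) := by
  classical
  have h : ({v : OPlusVertex r | p v.1}.ncard : ℤ) =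
      ∑ v : OPlusVertex r, if p v.1 then 1 else 0 := by
    rw [Set.ncard_eq_toFinset_card', Finset.sum_boole]
    congr 2
    ext; simp
  rw [h]
  simp only [ite_mul, one_mul, zero_mul]
  rw [← Finset.sum_filter (fun w : BinVec r => hypForm w = 1)]
  exact (Finset.sum_subtype _ (by simp) fun w : BinVec r => if p w then (1 : ℤ) else 0).symm

/-- The vertices contained in a subgroup. -/
def vertsIn (U : AddSubgroup (BinVec r)) : Set (OPlusVertex r) := {v | v.1 ∈ U}

theorem two_mul_ncard_vertsIn (U : AddSubgroup (BinVec r)) :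
    2 * ((vertsIn U).ncard : ℤ) = Nat.card U - quadSum U := by
  classical
  rw [vertsIn, ncard_oplusVertex (· ∈ U), quadSum]
  have h1 : (Nat.card U : ℤ) = ∑ _w : U, 1 := by simp
  rw [h1, ← Finset.sum_sub_distrib, sum_subgroup_eq U fun w => 1 - binSign (hypForm w),
    Finset.mul_sum]
  refine Finset.sum_congr rfl fun w _ => ?_
  rw [one_sub_binSign]
  split_ifs <;> ring

theorem two_mul_card_oplusVertex : 2 * (Nat.card (OPlusVertex r) : ℤ) = (2 ^ r) ^ 2 - 2 ^ r := by
  classical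
  have h := ncard_oplusVertex (r := r) fun _ => True
  simp only [Set.ofPred_true, Set.ncard_univ, if_true, mul_one] at h
  rw [h, Finset.mul_sum, ← card_binVec, ← sum_binSign_hypForm (r := r)]
  simp_rw [← one_sub_binSign, Finset.sum_sub_distrib]
  simp

theorem ne_zero_of_hypForm_eq_one {x : BinVec r} (hx : hypForm x = 1) : x ≠ 0 := by
  rintro rfl
  simp at hx

theorem four_mul_ncard_adj (x : OPlusVertex r) :
    4 * ({y | (OPlus r).Adj x y}.ncard : ℤ) = (2 ^ r) ^ 2 - 2 * 2 ^ r := by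
  have h := ncard_oplusVertex (r := r) fun w => sympForm x.1 w = 1
  change ({y | (OPlus r).Adj x y}.ncard : ℤ) = _ at h
  have h2 : ∀ w : BinVec r, 4 * ((if hypForm w = 1 then (1 : ℤ) else 0) *
      (if sympForm x.1 w = 1 then 1 else 0)) = 1 - binSign (hypForm w) -
        binSign (sympForm x.1 w) + binSign (hypForm w) * binSign (sympForm x.1 w) := fun w => by
    linear_combination -(2 * if sympForm x.1 w = 1 then (1 : ℤ) else 0) *
      one_sub_binSign (hypForm w) - (1 - binSign (hypForm w)) * one_sub_binSign (sympForm x.1 w)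
  rw [h, Finset.mul_sum, Finset.sum_congr rfl fun w _ => h2 w]
  simp only [Finset.sum_sub_distrib, Finset.sum_add_distrib, sum_binSign_hypForm,
    sum_binSign_hypForm_add_sympForm, sum_binSign_sympForm (ne_zero_of_hypForm_eq_one x.2), x.2,
    Finset.sum_const, Finset.card_univ, nsmul_eq_mul, card_binVec, binSign_one]
  ring

/-- Expand the product of the three indicators into characters. The remaining sign is -1 for
adjacent `x`, `y` and 1 otherwise, so one formula yields both λ and μ. -/
theorem eight_mul_ncard_common {x y : OPlusVertex r} (hxy : x ≠ y) :
    8 * ({z | (OPlus r).Adj x z ∧ (OPlus r).Adj y z}.ncard : ℤ) =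
      (2 ^ r) ^ 2 - 3 * 2 ^ r - 2 ^ r * binSign (hypForm (x.1 + y.1)) := by
  have h := ncard_oplusVertex (r := r) fun w => sympForm x.1 w = 1 ∧ sympForm y.1 w = 1
  change ({z | (OPlus r).Adj x z ∧ (OPlus r).Adj y z}.ncard : ℤ) = _ at h
  have key : ∀ q a b : ZMod 2, 8 * ((if q = 1 then (1 : ℤ) else 0) *
      (if a = 1 ∧ b = 1 then 1 else 0)) = 1 - binSign q - binSign a - binSign b +
        binSign (a + b) + binSign q * binSign a + binSign q * binSign b
        - binSign q * binSign (a + b) := by decide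
  have hne : x.1 + y.1 ≠ 0 := fun h0 => hxy <| Subtype.ext <| by
    rw [← add_zero x.1, ← BinVec.add_self y.1, ← add_assoc, h0, zero_add]
  rw [h, Finset.mul_sum]
  have e : ∀ w : BinVec r, 8 * ((if hypForm w = 1 then (1 : ℤ) else 0) *
      (if sympForm x.1 w = 1 ∧ sympForm y.1 w = 1 then 1 else 0)) = 1 - binSign (hypForm w)
        - binSign (sympForm x.1 w) - binSign (sympForm y.1 w) + binSign (sympForm (x.1 + y.1) w)
        + binSign (hypForm w) * binSign (sympForm x.1 w)
        + binSign (hypForm w) * binSign (sympForm y.1 w)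
        - binSign (hypForm w) * binSign (sympForm (x.1 + y.1) w) := fun w => by
    rw [sympForm_add_left, ← key]
  rw [Finset.sum_congr rfl fun w _ => e w]
  simp only [Finset.sum_sub_distrib, Finset.sum_add_distrib, sum_binSign_hypForm,
    sum_binSign_hypForm_add_sympForm, sum_binSign_sympForm (ne_zero_of_hypForm_eq_one x.2),
    sum_binSign_sympForm (ne_zero_of_hypForm_eq_one y.2), sum_binSign_sympForm hne, x.2, y.2,
    Finset.sum_const, Finset.card_univ, nsmul_eq_mul, card_binVec, binSign_one]
  ring

/-- A vertex of `U^⊥` outside `U` has a neighbour in `U^⊥`. -/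
theorem exists_adj_mem_orthGroup {U : AddSubgroup (BinVec r)} {z : OPlusVertex r}
    (hz : z.1 ∈ orthGroup U) (hzU : z.1 ∉ U)
    (hpos : 2 * quadSum (orthGroup U) < Nat.card (orthGroup U)) :
    ∃ w : OPlusVertex r, w.1 ∈ orthGroup U ∧ (OPlus r).Adj z w := by
  classical
  by_contra! hcon
  -- The summand is (1 - (-1)^Q(w))(1 - (-1)^⟨z,w⟩), four times the indicator of a neighbour of `z`;
  -- the whole sum evaluates to |U^⊥| - 2E(U^⊥).
  have h0 : ∑ w : orthGroup U, (1 - binSign (hypForm w.1) -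
        binSign (sympForm z.1 w.1) + binSign (hypForm w.1) * binSign (sympForm z.1 w.1)) = 0 := by
    refine Finset.sum_eq_zero fun w _ => ?_
    by_cases hw : hypForm w.1 = 1
    · have h1 := hcon ⟨w.1, hw⟩ w.2
      rw [OPlus_adj_iff, ← ne_eq, zmod_two_ne_one] at h1
      simp [hw, show sympForm z.1 w.1 = 0 from h1]
    · rw [← ne_eq, zmod_two_ne_one] at hw
      simp [hw]
  simp only [Finset.sum_sub_distrib, Finset.sum_add_distrib, sum_binSign_sympForm_orthGroup hzU,
    sum_binSign_hypForm_sympForm_subgroup hz, z.2, Finset.sum_const, Finset.card_univ,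
    nsmul_eq_mul, ← Nat.card_eq_fintype_card, binSign_one] at h0
  change _ - quadSum (orthGroup U) - _ + _ = _ at h0
  linarith

end CharacterSums

/-! ### Hyperbolic lines, their orthogonal complements, and the bound on separated sets. -/

section Separation

variable {r : ℕ}

/-- The subgroup `{0, x, y, x + y}`. -/
def lineGroup (x y : BinVec r) : AddSubgroup (BinVec r) where
  carrier := {0, x, y, x + y}
  zero_mem' := by simp
  add_mem' := by
    have hx := BinVec.add_self x
    have hy := BinVec.add_self y
    have h1 : y + (x + y) = x := by rw [add_left_comm, hy, add_zero]
    have h2 : x + (x + y) = y := by rw [← add_assoc, hx, zero_add]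
    have h3 : x + y + x = y := by rw [add_comm, h2]
    have h4 : x + y + y = x := by rw [add_comm, h1]
    have h5 := BinVec.add_self (x + y)
    rintro a b (ha | ha | ha | ha) (hb | hb | hb | hb) <;> rw [ha, hb] <;>
      simp [hx, hy, h1, h2, h3, h4, h5, add_comm y x]
  neg_mem' := by
    intro a ha
    rwa [neg_eq_of_add_eq_zero_left (BinVec.add_self a)]

theorem mem_lineGroup {x y w : BinVec r} :
    w ∈ lineGroup x y ↔ w = 0 ∨ w = x ∨ w = y ∨ w = x + y := Iff.rfl

theorem lineGroup_le {x y : BinVec r} {U : AddSubgroup (BinVec r)} (hx : x ∈ U) (hy : y ∈ U) :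
    lineGroup x y ≤ U := by
  rintro w (rfl | rfl | rfl | rfl)
  exacts [U.zero_mem, hx, hy, U.add_mem hx hy]

theorem mem_orthGroup_lineGroup {x y w : BinVec r} :
    w ∈ orthGroup (lineGroup x y) ↔ sympForm x w = 0 ∧ sympForm y w = 0 := by
  constructor
  · exact fun h => ⟨h _ (by simp [mem_lineGroup]), h _ (by simp [mem_lineGroup])⟩
  · rintro ⟨h1, h2⟩ u (rfl | rfl | rfl | rfl) <;> simp [sympForm_add_left, h1, h2]

variable {x y : OPlusVertex r}

theorem vertsIn_lineGroup (h : (OPlus r).Adj x y) :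
    vertsIn (lineGroup x.1 y.1) = OPlus.hyperbolicLine h := by
  ext v
  simp only [vertsIn, OPlus.hyperbolicLine, OPlus.sum, Set.mem_ofPred_eq, mem_lineGroup,
    ne_zero_of_hypForm_eq_one v.2, false_or, Set.mem_insert_iff, Set.mem_singleton_iff,
    Subtype.ext_iff]

theorem ncard_hyperbolicLine (h : (OPlus r).Adj x y) : (OPlus.hyperbolicLine h).ncard = 3 := by
  rw [Set.ncard_eq_three]
  refine ⟨x, y, OPlus.sum h, h.ne, fun e => ?_, fun e => ?_, rfl⟩
  · exact ne_zero_of_hypForm_eq_one y.2 (left_eq_add.1 (congrArg Subtype.val e))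
  · exact ne_zero_of_hypForm_eq_one x.2 (right_eq_add.1 (congrArg Subtype.val e))

theorem card_lineGroup (h : (OPlus r).Adj x y) : Nat.card (lineGroup x.1 y.1) = 4 := by
  have e : ((lineGroup x.1 y.1 : AddSubgroup _) : Set (BinVec r)) =
      insert 0 (Subtype.val '' OPlus.hyperbolicLine h) := by
    ext w
    simp [mem_lineGroup, OPlus.hyperbolicLine, OPlus.sum, Set.image_insert_eq]
  rw [← SetLike.coe_sort_coe, Nat.card_coe_set_eq, e, Set.ncard_insert_of_notMem,
    Set.ncard_image_of_injective _ Subtype.val_injective, ncard_hyperbolicLine]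
  rintro ⟨v, -, hv⟩
  exact ne_zero_of_hypForm_eq_one v.2 hv

theorem quadSum_lineGroup (h : (OPlus r).Adj x y) : quadSum (lineGroup x.1 y.1) = -2 := by
  have h1 := two_mul_ncard_vertsIn (lineGroup x.1 y.1)
  rw [vertsIn_lineGroup h, ncard_hyperbolicLine, card_lineGroup h] at h1
  push_cast at h1
  linarith

theorem four_mul_card_orthGroup_lineGroup (h : (OPlus r).Adj x y) :
    4 * (Nat.card (orthGroup (lineGroup x.1 y.1)) : ℤ) = (2 ^ r) ^ 2 := by
  have h1 := card_mul_card_orthGroup (lineGroup x.1 y.1)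
  rwa [card_lineGroup h] at h1

theorem two_mul_quadSum_orthGroup_lineGroup (h : (OPlus r).Adj x y) :
    2 * quadSum (orthGroup (lineGroup x.1 y.1)) = -2 ^ r := by
  have h1 := card_mul_quadSum_orthGroup (lineGroup x.1 y.1)
  rw [card_lineGroup h, quadSum_lineGroup h] at h1
  push_cast at h1
  linarith

theorem disjoint_vertsIn_lineGroup (h : (OPlus r).Adj x y) :
    Disjoint (vertsIn (lineGroup x.1 y.1)) (vertsIn (orthGroup (lineGroup x.1 y.1))) := by
  have hxy : sympForm x.1 y.1 = 1 := h
  rw [Set.disjoint_left]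
  intro v hv hv'
  obtain ⟨h1, h2⟩ := mem_orthGroup_lineGroup.1 hv'
  rcases hv with hv | hv | hv | hv
  · exact ne_zero_of_hypForm_eq_one v.2 hv
  · rw [hv, sympForm_comm, hxy] at h2
    exact one_ne_zero h2
  · rw [hv, hxy] at h1
    exact one_ne_zero h1
  · rw [hv, sympForm_add_right, sympForm_self, hxy] at h1
    simp at h1

theorem compl_nbhd_hyperbolicLine (h : (OPlus r).Adj x y) :
    (nbhd (OPlus r) (OPlus.hyperbolicLine h))ᶜ =
      vertsIn (lineGroup x.1 y.1) ∪ vertsIn (orthGroup (lineGroup x.1 y.1)) := by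
  rw [vertsIn_lineGroup h]
  ext v
  have h0 : v.1 ∈ orthGroup (lineGroup x.1 y.1) ↔
      ∀ u ∈ OPlus.hyperbolicLine h, ¬ (OPlus r).Adj u v := by
    simp only [OPlus_adj_iff, ← ne_eq, zmod_two_ne_one]
    rw [← vertsIn_lineGroup h]
    constructor
    · exact fun hv u hu => hv u.1 hu
    · intro hv
      rw [mem_orthGroup_lineGroup]
      exact ⟨hv x (by simp [vertsIn, mem_lineGroup]), hv y (by simp [vertsIn, mem_lineGroup])⟩
  simp only [nbhd, Set.mem_compl_iff, Set.mem_union, Set.mem_ofPred_eq, vertsIn, h0]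
  push Not
  tauto

theorem eight_mul_ncard_compl_nbhd (h : (OPlus r).Adj x y) :
    8 * ((nbhd (OPlus r) (OPlus.hyperbolicLine h))ᶜ.ncard : ℤ) =
      24 + (2 ^ r) ^ 2 + 2 * 2 ^ r := by
  rw [compl_nbhd_hyperbolicLine h, Set.ncard_union_eq (disjoint_vertsIn_lineGroup h),
    vertsIn_lineGroup h, ncard_hyperbolicLine]
  have h1 := two_mul_ncard_vertsIn (orthGroup (lineGroup x.1 y.1))
  have h2 := four_mul_card_orthGroup_lineGroup h
  have h3 := two_mul_quadSum_orthGroup_lineGroup h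
  push_cast
  linarith

/-- By convexity, w = N^2/u lies below its chord over [8, N], which is `h1`. The resulting bound is
linear in u with slope 6 - N/2, so it is worst at u = 8 or u = N according to whether N is above or
below 12. -/
theorem separation_arith {N u w : ℤ} (hN : 8 ≤ N) (hu : 8 ≤ u) (huN : u ≤ N)
    (huw : u * w = N ^ 2) : 6 * u + 4 * w < 24 + N ^ 2 := by
  have h1 : 8 * w ≤ N * (8 + N - u) := by
    refine le_of_mul_le_mul_left ?_ (by linarith : 0 < u)
    have h2 : 0 ≤ N * ((u - 8) * (N - u)) :=
      mul_nonneg (by linarith) (mul_nonneg (by linarith) (by linarith))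
    linear_combination h2 + 8 * huw
  rcases le_total 12 N with h | h
  · nlinarith [mul_nonneg (sub_nonneg.2 h) (sub_nonneg.2 hu)]
  · nlinarith [mul_nonneg (sub_nonneg.2 h) (sub_nonneg.2 huN)]

/-- The two character sum bounds give 8(|A| + |B|) ≤ 6|U| + 4|U^⊥| + 2·2^r. This equals the claimed
bound when |U| = 4 and is strictly smaller once 8 ≤ |U| ≤ 2^r. -/
theorem separated_bound_of_card_le (hr : 3 ≤ r) {U : AddSubgroup (BinVec r)}
    (hU : Nat.card U ≤ 2 ^ r) (h : (OPlus r).Adj x y) (hx : x.1 ∈ U) (hy : y.1 ∈ U)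
    {A B : Set (OPlusVertex r)} (hA : A ⊆ vertsIn U) (hB : B ⊆ vertsIn (orthGroup U)) :
    8 * (A.ncard + B.ncard : ℤ) ≤ 24 + (2 ^ r) ^ 2 + 2 * 2 ^ r ∧
      (8 * (A.ncard + B.ncard : ℤ) = 24 + (2 ^ r) ^ 2 + 2 * 2 ^ r →
        A ∪ B = (nbhd (OPlus r) (OPlus.hyperbolicLine h))ᶜ) := by
  have hN : (8 : ℤ) ≤ 2 ^ r := by
    calc (8 : ℤ) = 2 ^ 3 := by norm_num
      _ ≤ 2 ^ r := pow_le_pow_right₀ (by norm_num) hr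
  have hle := lineGroup_le hx hy
  have hA' : (A.ncard : ℤ) ≤ (vertsIn U).ncard := by
    exact_mod_cast Set.ncard_le_ncard hA (Set.toFinite _)
  have hB' : (B.ncard : ℤ) ≤ (vertsIn (orthGroup U)).ncard := by
    exact_mod_cast Set.ncard_le_ncard hB (Set.toFinite _)
  have hnA := two_mul_ncard_vertsIn U
  have hnB := two_mul_ncard_vertsIn (orthGroup U)
  have huw := card_mul_card_orthGroup U
  have hE := neg_card_le_two_mul_quadSum hx hy x.2 y.2 h
  have huE := card_mul_quadSum_orthGroup U
  have hE' : -2 ^ r ≤ 2 * quadSum (orthGroup U) := by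
    refine le_of_mul_le_mul_left ?_ (by exact_mod_cast Nat.card_pos : (0 : ℤ) < Nat.card U)
    have := mul_le_mul_of_nonneg_left hE (by linarith : (0 : ℤ) ≤ 2 ^ r)
    linarith
  -- The order divides 4^r, so it is a power of two; this leaves nothing strictly between 4 and 8.
  have h4 : Nat.card U = 4 ∨ 8 ≤ Nat.card U := by
    have hd : Nat.card U ∣ 2 ^ (r * 2) := ⟨Nat.card (orthGroup U), by
      rw [pow_mul]; exact_mod_cast huw.symm⟩
    obtain ⟨d, -, hd⟩ := (Nat.dvd_prime_pow Nat.prime_two).1 hd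
    have h4 : 4 ≤ Nat.card U := by
      rw [← card_lineGroup h]
      exact Nat.card_le_card_of_injective _ (AddSubgroup.inclusion_injective hle)
    rw [hd] at h4 ⊢
    rcases lt_trichotomy d 2 with h2 | h2 | h2
    · interval_cases d <;> omega
    · left; rw [h2]; rfl
    · right; exact Nat.pow_le_pow_right (n := 2) (by norm_num) h2
  rcases h4 with h4 | h4
  · have hUeq : lineGroup x.1 y.1 = U := by
      refine AddSubgroup.eq_of_le_of_card_ge hle ?_
      rw [h4, card_lineGroup h]
    rw [h4] at huw hE hnA
    push_cast at huw hE hnA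
    refine ⟨by linarith, fun heq => ?_⟩
    have hAe : A = vertsIn U := Set.eq_of_subset_of_ncard_le hA (by
      suffices ((vertsIn U).ncard : ℤ) ≤ A.ncard by exact_mod_cast this
      linarith)
    have hBe : B = vertsIn (orthGroup U) := Set.eq_of_subset_of_ncard_le hB (by
      suffices ((vertsIn (orthGroup U)).ncard : ℤ) ≤ B.ncard by exact_mod_cast this
      linarith)
    rw [compl_nbhd_hyperbolicLine h, hUeq, hAe, hBe]
  · have h5 := separation_arith hN (by exact_mod_cast h4) (by exact_mod_cast hU) huw
    have h6 : 8 * (A.ncard + B.ncard : ℤ) < 24 + (2 ^ r) ^ 2 + 2 * 2 ^ r := by linarith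
    exact ⟨h6.le, fun h7 => absurd h7 h6.ne⟩

/-- Two sets of vertices with no edges between them, each spanning an edge, are together at most
as large as the complement of the neighbourhood of a hyperbolic line, with equality only for such
complements. -/
theorem separated_bound (hr : 3 ≤ r) {A B : Set (OPlusVertex r)}
    (hAB : ∀ a ∈ A, ∀ b ∈ B, ¬ (OPlus r).Adj a b)
    (hA : ∃ a ∈ A, ∃ b ∈ A, (OPlus r).Adj a b) (hB : ∃ a ∈ B, ∃ b ∈ B, (OPlus r).Adj a b) :
    8 * (A.ncard + B.ncard : ℤ) ≤ 24 + (2 ^ r) ^ 2 + 2 * 2 ^ r ∧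
      (8 * (A.ncard + B.ncard : ℤ) = 24 + (2 ^ r) ^ 2 + 2 * 2 ^ r →
        ∃ (x y : OPlusVertex r) (h : (OPlus r).Adj x y),
          A ∪ B = (nbhd (OPlus r) (OPlus.hyperbolicLine h))ᶜ) := by
  have main : ∀ A B : Set (OPlusVertex r), (∀ a ∈ A, ∀ b ∈ B, ¬ (OPlus r).Adj a b) →
      B ⊆ vertsIn (orthGroup (AddSubgroup.closure (Subtype.val '' A))) := by
    intro A B hAB b hb u hu
    induction hu using AddSubgroup.closure_induction with
    | mem u hu =>
      obtain ⟨a, ha, rfl⟩ := hu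
      exact zmod_two_ne_one.1 (hAB a ha b hb)
    | zero => simp
    | add u v _ _ h1 h2 => rw [sympForm_add_left, h1, h2, add_zero]
    | neg u _ h1 => rwa [neg_eq_of_add_eq_zero_left (BinVec.add_self u)]
  have sub : ∀ A : Set (OPlusVertex r),
      A ⊆ vertsIn (AddSubgroup.closure (Subtype.val '' A)) :=
    fun A a ha => AddSubgroup.subset_closure ⟨a, ha, rfl⟩
  -- If the span of A has order above 2^r, its orthogonal complement has order at most 2^r and
  -- contains the span of B, so the roles of A and B are exchanged.
  rcases le_or_gt (Nat.card (AddSubgroup.closure (Subtype.val '' A))) (2 ^ r) with hU | hU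
  · obtain ⟨a, ha, b, hb, hab⟩ := hA
    have := separated_bound_of_card_le hr hU hab (sub A ha) (sub A hb) (sub A) (main A B hAB)
    exact ⟨this.1, fun h => ⟨a, b, hab, this.2 h⟩⟩
  · have hle : AddSubgroup.closure (Subtype.val '' B) ≤
        orthGroup (AddSubgroup.closure (Subtype.val '' A)) := by
      rw [AddSubgroup.closure_le]
      rintro _ ⟨b, hb, rfl⟩
      exact main A B hAB hb
    have hU' : Nat.card (AddSubgroup.closure (Subtype.val '' B)) ≤ 2 ^ r := by
      refine (Nat.card_le_card_of_injective _ (AddSubgroup.inclusion_injective hle)).trans ?_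
      have h1 : Nat.card (AddSubgroup.closure (Subtype.val '' A)) *
          Nat.card (orthGroup (AddSubgroup.closure (Subtype.val '' A))) = (2 ^ r) ^ 2 := by
        exact_mod_cast card_mul_card_orthGroup (AddSubgroup.closure (Subtype.val '' A))
      by_contra! h2
      exact (Nat.mul_lt_mul'' hU h2).ne' (h1.trans (sq _))
    obtain ⟨a, ha, b, hb, hab⟩ := hB
    have := separated_bound_of_card_le hr hU' hab (sub B ha) (sub B hb) (sub B)
      (main B A fun b hb a ha h => hAB a ha b hb h.symm)
    rw [add_comm (A.ncard : ℤ), Set.union_comm]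
    exact ⟨this.1, fun h => ⟨a, b, hab, this.2 h⟩⟩

end Separation

/-! ### From components to separations, in an arbitrary graph. -/

theorem SimpleGraph.ConnectedComponent.exists_adj_of_nontrivial {V : Type*} {G : SimpleGraph V}
    (c : G.ConnectedComponent) (hc : c.supp.Nontrivial) :
    ∃ a ∈ c.supp, ∃ b ∈ c.supp, G.Adj a b := by
  obtain ⟨a, ha, b, hb, hab⟩ := hc
  obtain ⟨p⟩ := SimpleGraph.ConnectedComponent.exact (ha.trans hb.symm)
  cases p with
  | nil => exact absurd rfl hab
  | cons h p => exact ⟨a, ha, _, (SimpleGraph.ConnectedComponent.sound h.symm.reachable).trans ha, h⟩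

theorem IsNonsingletonDisconnecting.exists_separation {V : Type*} {G : SimpleGraph V} {S : Set V}
    (hS : IsNonsingletonDisconnecting G S) :
    ∃ A B : Set V, A ∪ B = Sᶜ ∧ Disjoint A B ∧ (∀ a ∈ A, ∀ b ∈ B, ¬ G.Adj a b) ∧
      (∃ a ∈ A, ∃ b ∈ A, G.Adj a b) ∧ (∃ a ∈ B, ∃ b ∈ B, G.Adj a b) := by
  have h := hS.disconnected
  simp only [SimpleGraph.Preconnected, not_forall] at h
  obtain ⟨u, v, huv⟩ := h
  set c := (G.induce Sᶜ).connectedComponentMk u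
  set d := (G.induce Sᶜ).connectedComponentMk v
  have hcd : c ≠ d := fun e => huv (SimpleGraph.ConnectedComponent.exact e)
  -- A is one component and B the union of all others; the second component `d` supplies an edge
  -- inside B.
  refine ⟨Subtype.val '' c.supp, Subtype.val '' c.suppᶜ, ?_, ?_, ?_, ?_, ?_⟩
  · rw [← Set.image_union, Set.union_compl_self, Set.image_univ, Subtype.range_coe]
  · exact (Set.disjoint_image_iff Subtype.val_injective).2 disjoint_compl_right
  · rintro _ ⟨a, ha, rfl⟩ _ ⟨b, hb, rfl⟩ hab
    have hab' : (G.induce Sᶜ).Adj a b := hab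
    exact hb ((SimpleGraph.ConnectedComponent.sound hab'.symm.reachable).trans ha)
  · obtain ⟨a, ha, b, hb, hab⟩ := c.exists_adj_of_nontrivial (hS.nonsingleton c)
    exact ⟨a, ⟨a, ha, rfl⟩, b, ⟨b, hb, rfl⟩, hab⟩
  · obtain ⟨a, ha, b, hb, hab⟩ := d.exists_adj_of_nontrivial (hS.nonsingleton d)
    exact ⟨a, ⟨a, fun e => hcd (e.symm.trans ha), rfl⟩, b,
      ⟨b, fun e => hcd (e.symm.trans hb), rfl⟩, hab⟩

/-! ### Graph parameters, extremality of line neighbourhoods, and the main theorem. -/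

section Main

variable {r : ℕ}

theorem isNonsingletonDisconnecting_nbhd_hyperbolicLine (hr : 3 ≤ r) {x y : OPlusVertex r}
    (h : (OPlus r).Adj x y) :
    IsNonsingletonDisconnecting (OPlus r) (nbhd (OPlus r) (OPlus.hyperbolicLine h)) := by
  have hN : (8 : ℤ) ≤ 2 ^ r := by
    calc (8 : ℤ) = 2 ^ 3 := by norm_num
      _ ≤ 2 ^ r := pow_le_pow_right₀ (by norm_num) hr
  set S := nbhd (OPlus r) (OPlus.hyperbolicLine h)
  set U := lineGroup x.1 y.1
  have hS : Sᶜ = vertsIn U ∪ vertsIn (orthGroup U) := compl_nbhd_hyperbolicLine h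
  have hdis : Disjoint (vertsIn U) (vertsIn (orthGroup U)) := disjoint_vertsIn_lineGroup h
  have hQ := two_mul_quadSum_orthGroup_lineGroup h
  have hw := four_mul_card_orthGroup_lineGroup h
  have hno : ∀ a ∈ vertsIn U, ∀ b ∈ vertsIn (orthGroup U), ¬ (OPlus r).Adj a b :=
    fun a ha b hb hab => zero_ne_one ((hb a.1 ha).symm.trans hab)
  constructor
  · intro hpre
    have hne : (vertsIn (orthGroup U)).Nonempty := by
      rw [← Set.ncard_pos (Set.toFinite _)]
      have h1 := two_mul_ncard_vertsIn (orthGroup U)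
      have h2 : (0 : ℤ) ≤ Nat.card (orthGroup U) := by positivity
      have h3 : (0 : ℤ) < (vertsIn (orthGroup U)).ncard := by linarith
      exact_mod_cast h3
    obtain ⟨z, hz⟩ := hne
    have hxS : x ∈ Sᶜ := by
      rw [hS]; left; simp [vertsIn, U, mem_lineGroup]
    have hzS : z ∈ Sᶜ := by
      rw [hS]; right; exact hz
    have hreach : ∀ a b : (Sᶜ : Set (OPlusVertex r)), ((OPlus r).induce Sᶜ).Walk a b →
        a.1 ∈ vertsIn U → b.1 ∈ vertsIn U := by
      intro a b p
      induction p with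
      | nil => exact id
      | @cons a c b hac p ih =>
        intro ha
        refine ih ?_
        have hc : c.1 ∈ vertsIn U ∪ vertsIn (orthGroup U) := hS ▸ c.2
        exact hc.resolve_right fun hc => hno _ ha _ hc hac
    obtain ⟨p⟩ := hpre ⟨x, hxS⟩ ⟨z, hzS⟩
    exact Set.disjoint_left.1 hdis (hreach _ _ p (by simp [vertsIn, U, mem_lineGroup])) hz
  · intro c
    obtain ⟨⟨z, hzS⟩, rfl⟩ := c.exists_rep
    suffices ∃ w ∈ Sᶜ, (OPlus r).Adj z w by
      obtain ⟨w, hwS, hzw⟩ := this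
      have hadj : ((OPlus r).induce Sᶜ).Adj ⟨z, hzS⟩ ⟨w, hwS⟩ := hzw
      exact ⟨⟨z, hzS⟩, rfl, ⟨w, hwS⟩,
        SimpleGraph.ConnectedComponent.sound hadj.symm.reachable, hadj.ne⟩
    rw [hS]
    have hz : z ∈ vertsIn U ∪ vertsIn (orthGroup U) := hS ▸ hzS
    rcases hz with hz | hz
    · have hxU : x ∈ vertsIn U := by simp [vertsIn, U, mem_lineGroup]
      have hyU : y ∈ vertsIn U := by simp [vertsIn, U, mem_lineGroup]
      rcases hz with hz | hz | hz | hz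
      · exact absurd hz (ne_zero_of_hypForm_eq_one z.2)
      · exact ⟨y, Or.inl hyU, by rw [OPlus_adj_iff, hz]; exact h⟩
      · exact ⟨x, Or.inl hxU, by rw [OPlus_adj_iff, hz]; exact h.symm⟩
      · refine ⟨x, Or.inl hxU, ?_⟩
        rw [OPlus_adj_iff, hz, sympForm_add_left, sympForm_self, zero_add]
        exact h.symm
    -- The sum over U^⊥ is -2^r/2, hence negative, so the required strict inequality is immediate.
    · obtain ⟨w, hw, hzw⟩ := exists_adj_mem_orthGroup hz
        (fun hzU => Set.disjoint_left.1 hdis hzU hz) (by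
          have h2 : (0 : ℤ) < Nat.card (orthGroup U) := by exact_mod_cast Nat.card_pos
          linarith)
      exact ⟨w, Or.inr hw, hzw⟩

theorem OPlus_isSRGWith (hr : 3 ≤ r) :
    (OPlus r).IsSRGWith (2 ^ (2 * r - 1) - 2 ^ (r - 1)) (2 ^ (2 * r - 2) - 2 ^ (r - 1))
      (2 ^ (2 * r - 3) - 2 ^ (r - 2)) (2 ^ (2 * r - 3) - 2 ^ (r - 1)) := by
  -- With r = s + 3 every power is a multiple of 2^s or 2^s·2^s. These become atoms for `omega`, and
  -- `hm` keeps the natural subtractions from truncating.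
  obtain ⟨s, rfl⟩ := Nat.exists_eq_add_of_le' hr
  have e1 : (2 : ℕ) ^ (2 * (s + 3) - 1) = 32 * (2 ^ s * 2 ^ s) := by
    rw [show 2 * (s + 3) - 1 = s + s + 5 by omega, pow_add, pow_add]; ring
  have e2 : (2 : ℕ) ^ (2 * (s + 3) - 2) = 16 * (2 ^ s * 2 ^ s) := by
    rw [show 2 * (s + 3) - 2 = s + s + 4 by omega, pow_add, pow_add]; ring
  have e3 : (2 : ℕ) ^ (2 * (s + 3) - 3) = 8 * (2 ^ s * 2 ^ s) := by
    rw [show 2 * (s + 3) - 3 = s + s + 3 by omega, pow_add, pow_add]; ring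
  have e4 : (2 : ℕ) ^ (s + 3 - 1) = 4 * 2 ^ s := by
    rw [show s + 3 - 1 = s + 2 by omega, pow_add]; ring
  have e5 : (2 : ℕ) ^ (s + 3 - 2) = 2 * 2 ^ s := by
    rw [show s + 3 - 2 = s + 1 by omega, pow_add]; ring
  have e6 : (2 : ℤ) ^ (s + 3) = 8 * ((2 ^ s : ℕ) : ℤ) := by push_cast; ring
  have e7 : ((2 : ℤ) ^ (s + 3)) ^ 2 = 64 * ((2 ^ s * 2 ^ s : ℕ) : ℤ) := by push_cast; ring
  have hm : 2 ^ s ≤ 2 ^ s * 2 ^ s := Nat.le_mul_of_pos_left _ (by positivity)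
  rw [e1, e2, e3, e4, e5]
  constructor
  · have h := two_mul_card_oplusVertex (r := s + 3)
    rw [e7, e6, Nat.card_eq_fintype_card] at h
    omega
  · intro x
    have h := four_mul_ncard_adj x
    rw [e7, e6, Set.ncard_eq_toFinset_card'] at h
    rw [← SimpleGraph.card_neighborFinset_eq_degree]
    have e : (OPlus (s + 3)).neighborFinset x = {y | (OPlus (s + 3)).Adj x y}.toFinset := by
      ext; simp
    rw [e]
    omega
  · intro x y hxy
    have h := eight_mul_ncard_common hxy.ne
    rw [show hypForm (x.1 + y.1) = 1 from (OPlus.sum hxy).2, e7, e6, binSign_one] at h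
    rw [← Nat.card_eq_fintype_card, Nat.card_coe_set_eq]
    change 8 * (((OPlus (s + 3)).commonNeighbors x y).ncard : ℤ) = _ at h
    omega
  · intro x y hxy hn
    have h := eight_mul_ncard_common hxy
    rw [OPlus_adj_iff, ← ne_eq, zmod_two_ne_one] at hn
    rw [hypForm_add', x.2, y.2, hn, show (1 + 1 + 0 : ZMod 2) = 0 by decide, e7, e6,
      binSign_zero] at h
    rw [← Nat.card_eq_fintype_card, Nat.card_coe_set_eq]
    change 8 * (((OPlus (s + 3)).commonNeighbors x y).ncard : ℤ) = _ at h
    omega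

theorem OPlus_nonempty (hr : 3 ≤ r) : Nonempty (OPlusVertex r) := by
  have hN : (8 : ℤ) ≤ 2 ^ r := by
    calc (8 : ℤ) = 2 ^ 3 := by norm_num
      _ ≤ 2 ^ r := pow_le_pow_right₀ (by norm_num) hr
  have h := two_mul_card_oplusVertex (r := r)
  have h1 : (0 : ℤ) < Nat.card (OPlusVertex r) := by nlinarith
  exact (Nat.card_pos_iff.1 (by exact_mod_cast h1)).1

theorem OPlus_exists_adj (hr : 3 ≤ r) (x : OPlusVertex r) : ∃ y, (OPlus r).Adj x y := by
  have hN : (8 : ℤ) ≤ 2 ^ r := by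
    calc (8 : ℤ) = 2 ^ 3 := by norm_num
      _ ≤ 2 ^ r := pow_le_pow_right₀ (by norm_num) hr
  have h := four_mul_ncard_adj x
  have h1 : (0 : ℤ) < {y | (OPlus r).Adj x y}.ncard := by nlinarith
  exact (Set.ncard_pos (Set.toFinite _)).1 (by exact_mod_cast h1)

/-- Distinct vertices always have a common neighbour: eight times their number is at least N^2 - 4N
> 0, where N = 2^r. -/
theorem OPlus_connected (hr : 3 ≤ r) : (OPlus r).Connected := by
  have hN : (8 : ℤ) ≤ 2 ^ r := by
    calc (8 : ℤ) = 2 ^ 3 := by norm_num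
      _ ≤ 2 ^ r := pow_le_pow_right₀ (by norm_num) hr
  have := OPlus_nonempty hr
  refine ⟨fun x y => ?_⟩
  by_cases hxy : x = y
  · rw [hxy]
  have h := eight_mul_ncard_common hxy
  have hs : binSign (hypForm (x.1 + y.1)) ≤ 1 := by
    generalize hypForm (x.1 + y.1) = a
    revert a; decide
  have h1 : (0 : ℤ) < {z | (OPlus r).Adj x z ∧ (OPlus r).Adj y z}.ncard := by nlinarith
  obtain ⟨z, hxz, hyz⟩ := (Set.ncard_pos (Set.toFinite _)).1 (by exact_mod_cast h1)
  exact hxz.reachable.trans hyz.symm.reachable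

theorem ncard_compl_le_of_isNonsingletonDisconnecting (hr : 3 ≤ r) {S : Set (OPlusVertex r)}
    (hS : IsNonsingletonDisconnecting (OPlus r) S) :
    8 * (Sᶜ.ncard : ℤ) ≤ 24 + (2 ^ r) ^ 2 + 2 * 2 ^ r ∧
      (8 * (Sᶜ.ncard : ℤ) = 24 + (2 ^ r) ^ 2 + 2 * 2 ^ r →
        ∃ (x y : OPlusVertex r) (h : (OPlus r).Adj x y),
          S = nbhd (OPlus r) (OPlus.hyperbolicLine h)) := by
  obtain ⟨A, B, hAB, hdis, hno, hA, hB⟩ := hS.exists_separation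
  have h := separated_bound hr hno hA hB
  rw [← hAB, Set.ncard_union_eq hdis]
  push_cast
  refine ⟨h.1, fun he => ?_⟩
  obtain ⟨x, y, hxy, e⟩ := h.2 he
  exact ⟨x, y, hxy, compl_injective (hAB.symm.trans e)⟩

theorem eight_mul_ncard_eq_sub_compl (S : Set (OPlusVertex r)) :
    8 * (S.ncard : ℤ) = 4 * (2 ^ r) ^ 2 - 4 * 2 ^ r - 8 * Sᶜ.ncard := by
  have h1 := two_mul_card_oplusVertex (r := r)
  rw [← Set.ncard_add_ncard_compl S] at h1
  push_cast at h1
  linarith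

theorem ncard_nbhd_hyperbolicLine {x y : OPlusVertex r} (h : (OPlus r).Adj x y) :
    8 * ((nbhd (OPlus r) (OPlus.hyperbolicLine h)).ncard : ℤ) =
      3 * (2 ^ r) ^ 2 - 6 * 2 ^ r - 24 := by
  rw [eight_mul_ncard_eq_sub_compl, eight_mul_ncard_compl_nbhd]
  ring

theorem kappaTwo_OPlus (hr : 3 ≤ r) {x y : OPlusVertex r} (h : (OPlus r).Adj x y) :
    kappaTwo (OPlus r) = ((nbhd (OPlus r) (OPlus.hyperbolicLine h)).ncard : ℕ∞) := by
  refine le_antisymm ?_ (le_iInf₂ fun S hS => ?_)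
  · rw [Set.Finite.cast_ncard_eq (Set.toFinite _)]
    exact iInf₂_le _ (isNonsingletonDisconnecting_nbhd_hyperbolicLine hr h)
  · rw [← Set.Finite.cast_ncard_eq (Set.toFinite S)]
    have h1 := (ncard_compl_le_of_isNonsingletonDisconnecting hr hS).1
    have h2 := eight_mul_ncard_eq_sub_compl S
    have h3 := ncard_nbhd_hyperbolicLine h
    have h4 : ((nbhd (OPlus r) (OPlus.hyperbolicLine h)).ncard : ℤ) ≤ S.ncard := by linarith
    exact_mod_cast h4

theorem ncard_nbhd_hyperbolicLine_eq (hr : 3 ≤ r) {x y : OPlusVertex r}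
    (h : (OPlus r).Adj x y) :
    (nbhd (OPlus r) (OPlus.hyperbolicLine h)).ncard =
        2 * (2 ^ (2 * r - 2) - 2 ^ (r - 1)) - (2 ^ (2 * r - 3) - 2 ^ (r - 2)) - 3 ∧
      (nbhd (OPlus r) (OPlus.hyperbolicLine h)).ncard =
        3 * (2 ^ (2 * r - 3) - 2 ^ (r - 2)) - 3 := by
  have h1 := ncard_nbhd_hyperbolicLine h
  generalize (nbhd (OPlus r) (OPlus.hyperbolicLine h)).ncard = n at h1
  obtain ⟨s, hs⟩ := Nat.exists_eq_add_of_le' hr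
  have e2 : (2 : ℕ) ^ (2 * r - 2) = 16 * (2 ^ s * 2 ^ s) := by
    rw [show 2 * r - 2 = s + s + 4 by omega, pow_add, pow_add]; ring
  have e3 : (2 : ℕ) ^ (2 * r - 3) = 8 * (2 ^ s * 2 ^ s) := by
    rw [show 2 * r - 3 = s + s + 3 by omega, pow_add, pow_add]; ring
  have e4 : (2 : ℕ) ^ (r - 1) = 4 * 2 ^ s := by
    rw [show r - 1 = s + 2 by omega, pow_add]; ring
  have e5 : (2 : ℕ) ^ (r - 2) = 2 * 2 ^ s := by
    rw [show r - 2 = s + 1 by omega, pow_add]; ring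
  have e6 : (2 : ℤ) ^ r = 8 * ((2 ^ s : ℕ) : ℤ) := by rw [hs]; push_cast; ring
  have e7 : ((2 : ℤ) ^ r) ^ 2 = 64 * ((2 ^ s * 2 ^ s : ℕ) : ℤ) := by
    rw [hs]; push_cast; ring
  have hm : 2 ^ s ≤ 2 ^ s * 2 ^ s := Nat.le_mul_of_pos_left _ (by positivity)
  rw [e7, e6] at h1
  rw [e2, e3, e4, e5]
  constructor <;> omega

end Main

theorem mainTheorem3 (r : ℕ) (hr : 3 ≤ r) :
    (OPlus r).Connected ∧
    (OPlus r).IsSRGWith (2 ^ (2 * r - 1) - 2 ^ (r - 1)) (2 ^ (2 * r - 2) - 2 ^ (r - 1))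
      (2 ^ (2 * r - 3) - 2 ^ (r - 2)) (2 ^ (2 * r - 3) - 2 ^ (r - 1)) ∧
    kappaTwo (OPlus r) =
      ((2 * (2 ^ (2 * r - 2) - 2 ^ (r - 1)) - (2 ^ (2 * r - 3) - 2 ^ (r - 2)) - 3 : ℕ) : ℕ∞) ∧
    kappaTwo (OPlus r) = ((3 * (2 ^ (2 * r - 3) - 2 ^ (r - 2)) - 3 : ℕ) : ℕ∞) ∧
    ∀ S : Set (OPlusVertex r),
      (IsNonsingletonDisconnecting (OPlus r) S ∧ S.encard = kappaTwo (OPlus r)) ↔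
        ∃ (x y : OPlusVertex r) (h : (OPlus r).Adj x y),
          S = nbhd (OPlus r) (OPlus.hyperbolicLine h) := by
  obtain ⟨x⟩ := OPlus_nonempty hr
  obtain ⟨y, h⟩ := OPlus_exists_adj hr x
  refine ⟨OPlus_connected hr, OPlus_isSRGWith hr, ?_, ?_, fun S => ⟨?_, ?_⟩⟩
  · rw [kappaTwo_OPlus hr h, (ncard_nbhd_hyperbolicLine_eq hr h).1]
  · rw [kappaTwo_OPlus hr h, (ncard_nbhd_hyperbolicLine_eq hr h).2]
  · rintro ⟨hS, hcard⟩
    refine (ncard_compl_le_of_isNonsingletonDisconnecting hr hS).2 ?_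
    rw [kappaTwo_OPlus hr h, ← Set.Finite.cast_ncard_eq (Set.toFinite S)] at hcard
    have h1 : (S.ncard : ℤ) = (nbhd (OPlus r) (OPlus.hyperbolicLine h)).ncard := by
      exact_mod_cast hcard
    have h2 := eight_mul_ncard_eq_sub_compl S
    have h3 := ncard_nbhd_hyperbolicLine h
    linarith
  · rintro ⟨x, y, h, rfl⟩
    refine ⟨isNonsingletonDisconnecting_nbhd_hyperbolicLine hr h, ?_⟩
    rw [kappaTwo_OPlus hr h, Set.Finite.cast_ncard_eq (Set.toFinite _)]
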